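/- Let $F$ be a field, let $V$ be a non-zero finite-dimensional vector space over $F$, and let $f:V\times V\to F$ be an arbitrary bilinear form. Let $$L(f)=\{x\in\mathfrak{gl}(V) : f(xv,w)=-f(v,xw)\ \text{for all } v,w\in V\},$$ a Lie subalgebra of $\mathfrak{gl}(V)$. Then the Lie algebra $L(f)$ is simple (that is, non-abelian and without ideals other than $0$ and itself) if and only if $\mathrm{char}(F)\neq 2$, $f$ is non-degenerate (no non-zero $u\in V$ satisfies $f(u,V)=0$, equivalently none satisfies $f(V,u)=0$), and exactly one of the following three conditions holds: (i) $f$ is skew-symmetric, i.e. $f(v,w)=-f(w,v)$ for all $v,w\in V$; (ii) $f$ is symmetric, $\dim V>2$, and if $\dim V=4$ then the discriminant of $f$ (the determinant of a Gram matrix of $f$, well defined up to multiplication by non-zero squares) is not a square in $F$; (iii) $f=f_1\perp f_{-1}$, i.e. there are subspaces $V_1,V_{-1}$ of $V$ with $V=V_1\oplus V_{-1}$ and $f(V_1,V_{-1})=0=f(V_{-1},V_1)$, such that the restriction $f_1$ of $f$ to $V_1$ is symmetric, the restriction $f_{-1}$ of $f$ to $V_{-1}$ is skew-symmetric, $\dim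 V_1=1$ and $\dim V_{-1}>0$. -/

import Mathlib

namespace BilinLie

open Module

attribute [local instance] LieRing.ofAssociativeRing

variable {F V : Type*} [Field F] [AddCommGroup V] [Module F V]

/-- `L(f)`: the Lie subalgebra of `gl(V)` of all `x` with `f (x v) w = - f v (x w)`. -/
abbrev L (f : LinearMap.BilinForm F V) : LieSubalgebra F (Module.End F V) :=
  skewAdjointLieSubalgebra f

theorem mem_L_iff (f : LinearMap.BilinForm F V) (x : Module.End F V) :
    x ∈ L f ↔ ∀ v w, f (x v) w = - f v (x w) := by
  change x ∈ f.skewAdjointSubmodule ↔ _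
  rw [LinearMap.mem_skewAdjointSubmodule]
  simp [LinearMap.IsSkewAdjoint, LinearMap.IsAdjointPair]

/-- `f` is skew-symmetric. -/
def IsSkewSymm (f : LinearMap.BilinForm F V) : Prop :=
  ∀ v w, f v w = - f w v

/-- `V = U ⊥ W` with respect to `f`: `V = U ⊕ W` and `f(U, W) = 0 = f(W, U)`. -/
def IsOrthogonalDecomp (f : LinearMap.BilinForm F V) (U W : Submodule F V) : Prop :=
  IsCompl U W ∧ (∀ u ∈ U, ∀ w ∈ W, f u w = 0) ∧ (∀ u ∈ U, ∀ w ∈ W, f w u = 0)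

/-- `f` is symmetric, `dim V > 2`, and if `dim V = 4` then the discriminant of `f` is not a
square in `F`. The discriminant is the determinant of a Gram matrix; being a square does not
depend on the basis, since a change of basis multiplies it by a nonzero square. -/
def IsSymmCase (f : LinearMap.BilinForm F V) : Prop :=
  f.IsSymm ∧ 2 < finrank F V ∧
    (finrank F V = 4 →
      ∀ b : Basis (Fin 4) F V, ¬ IsSquare (LinearMap.BilinForm.toMatrix b f).det)

/-- `f = f₁ ⊥ f₋₁` with `f₁` symmetric on a space of dimension 1 and `f₋₁` skew-symmetric on a
nonzero space. -/
def IsMixedCase (f : LinearMap.BilinForm F V) : Prop :=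
  ∃ U W : Submodule F V, IsOrthogonalDecomp f U W ∧
    (f.restrict U).IsSymm ∧ IsSkewSymm (f.restrict W) ∧
    finrank F U = 1 ∧ 0 < finrank F W

/-- Exactly one of three propositions holds. -/
def ExactlyOne (A B C : Prop) : Prop :=
  (A ∧ ¬ B ∧ ¬ C) ∨ (¬ A ∧ B ∧ ¬ C) ∨ (¬ A ∧ ¬ B ∧ C)

end BilinLie

namespace BilinLie

open Module

attribute [local instance] LieRing.ofAssociativeRing

/-! Necessity. A simple `L f` has no nonzero central element, and every linear functional that
vanishes on commutators vanishes on it. Characteristic two would make the identity central. The left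
and right radicals of `f` are invariant, and traces on invariant subspaces together with abelian
ideals force them to be zero. For non-degenerate `f` the asymmetry `σ`, with `f (σ v) w = f w v`,
commutes with `L f`, and `σ - σ⁻¹` lies in `L f`, so `σ² = 1`. Its eigenspaces split `V` into an
invariant symmetric part `U` and an invariant skew part `W`. The operators killing `W` form an
ideal, so `W = 0` or `dim U ≤ 1`. If `W = 0`, dimension at most two makes `L f` abelian, and
dimension four with square discriminant gives an ideal of self-dual elements.

Sufficiency. The operators `T f a b` behave like `a ∧ b` or `a · b`, and since `2` is invertible,
dual bases write elements of `L f` through them. In the skew and mixed cases a nonzero ideal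
contains some `T f a a` with `a ∈ W`, which spreads to all of `W` (`SymmSkewDecomp.isSimple`). In
the symmetric case, double commutators with `T f (b p) (b q)` for an orthogonal basis `b` filter the
matrix entries of an ideal element until one basis operator is isolated. In dimension four a
complementary one may survive too, and a non-square discriminant separates the two
(`IsOrthogonalBasis.isSimple`). -/

/-- Simplicity of a Lie subalgebra of an associative algebra, in terms of the ambient algebra. -/
theorem isSimple_lieSubalgebra_iff {F A : Type*} [Field F] [Ring A] [Algebra F A]
    (K : LieSubalgebra F A) :
    LieAlgebra.IsSimple F K ↔ (∃ x ∈ K, ∃ y ∈ K, x * y ≠ y * x) ∧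
      ∀ P : Submodule F A, P ≤ K.toSubmodule → (∀ x ∈ K, ∀ y ∈ P, x * y - y * x ∈ P) →
        P = ⊥ ∨ K.toSubmodule ≤ P := by
  constructor
  · intro h
    constructor
    · by_contra! hc
      refine h.non_abelian ⟨fun x y => ?_⟩
      apply Subtype.ext
      simp [LieRing.of_associative_ring_bracket, hc x x.2 y y.2]
    · intro P hPK hP
      let I : LieIdeal F K :=
        { P.comap K.toSubmodule.subtype with
          lie_mem := by
            intro x y hy
            exact hP x x.2 y hy }
      have hI : ∀ y : K, y ∈ I ↔ (y : A) ∈ P := fun y => Iff.rfl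
      rcases h.eq_bot_or_eq_top I with h0 | h1
      · left
        rw [eq_bot_iff]
        intro y hy
        have : (⟨y, hPK hy⟩ : K) ∈ I := hy
        rw [h0, LieSubmodule.mem_bot] at this
        simpa using congrArg Subtype.val this
      · right
        intro y hy
        have : (⟨y, hy⟩ : K) ∈ I := by rw [h1]; trivial
        exact this
  · rintro ⟨⟨x, hx, y, hy, hxy⟩, h⟩
    refine ⟨fun I => ?_, fun hab => hxy ?_⟩
    · have h' := h (I.toSubmodule.map K.toSubmodule.subtype)
        (by
          rintro _ ⟨w, -, rfl⟩
          exact w.2)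
        (by
          rintro x hx _ ⟨w, hw, rfl⟩
          exact ⟨⁅(⟨x, hx⟩ : K), w⁆, I.lie_mem hw, rfl⟩)
      rcases h' with h0 | h1
      · left
        rw [eq_bot_iff]
        intro z hz
        have : (z : A) ∈ I.toSubmodule.map K.toSubmodule.subtype := ⟨z, hz, rfl⟩
        rw [h0, Submodule.mem_bot] at this
        exact (LieSubmodule.mem_bot _).mpr (Subtype.ext this)
      · right
        rw [eq_top_iff]
        rintro z -
        obtain ⟨w, hw, hwz⟩ := h1 z.2
        have : w = z := Subtype.ext hwz
        exact this ▸ hw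
    · have := congrArg Subtype.val (hab.trivial ⟨x, hx⟩ ⟨y, hy⟩)
      exact sub_eq_zero.mp this

variable {F V : Type*} [Field F] [AddCommGroup V] [Module F V]

/-! ### Obstructions to simplicity: traces, abelian ideals, centre -/

section Simple

variable {f : LinearMap.BilinForm F V}

theorem commutator_mem_L {x y : Module.End F V} (hx : x ∈ L f) (hy : y ∈ L f) :
    x * y - y * x ∈ L f := (L f).lie_mem hx hy

/-- Linear functionals vanishing on commutators vanish on a simple Lie algebra. -/
theorem eq_zero_of_forall_commutator (h : LieAlgebra.IsSimple F (L f))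
    (φ : Module.End F V →ₗ[F] F) (hφ : ∀ x ∈ L f, ∀ y ∈ L f, φ (x * y - y * x) = 0)
    {x : Module.End F V} (hx : x ∈ L f) : φ x = 0 := by
  rw [isSimple_lieSubalgebra_iff] at h
  obtain ⟨⟨a, ha, b, hb, hab⟩, h⟩ := h
  rcases h ((L f).toSubmodule ⊓ LinearMap.ker φ) inf_le_left
    (fun x hx y hy => ⟨commutator_mem_L hx hy.1, hφ x hx y hy.1⟩) with h0 | h1
  · have : a * b - b * a ∈ (L f).toSubmodule ⊓ LinearMap.ker φ :=
      ⟨commutator_mem_L ha hb, hφ a ha b hb⟩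
    rw [h0, Submodule.mem_bot, sub_eq_zero] at this
    exact absurd this hab
  · exact (h1 hx).2

/-- Trace of a rank-one restriction to an invariant subspace. -/
theorem apply_eq_zero_of_invariant [FiniteDimensional F V] (h : LieAlgebra.IsSimple F (L f))
    (W : Submodule F V) (hW : ∀ x ∈ L f, ∀ w ∈ W, x w ∈ W) {x : Module.End F V} (hx : x ∈ L f)
    (ψ : V →ₗ[F] F) {z : V} (hz : z ∈ W) (hxz : ∀ w ∈ W, x w = ψ w • z) : ψ z = 0 := by
  -- A retraction onto `W` extends restriction to `W` to a linear map on all endomorphisms. It is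
  -- multiplicative on `L f` because `W` is invariant.
  obtain ⟨p, hp⟩ := W.subtype.exists_leftInverse_of_injective (Submodule.ker_subtype W)
  have hpw : ∀ w : W, p w = w := fun w => LinearMap.congr_fun hp w
  let Φ : Module.End F V →ₗ[F] Module.End F W :=
    { toFun := fun y => p ∘ₗ y ∘ₗ W.subtype
      map_add' := by intros; ext; simp
      map_smul' := by intros; ext; simp }
  have hΦ : ∀ y w, Φ y w = p (y w) := fun y w => rfl
  have hmul : ∀ y, ∀ y' ∈ L f, Φ (y * y') = Φ y * Φ y' := by
    intro y y' hy'
    ext w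
    have h1 : ((p (y' w) : W) : V) = y' w := by
      have := hpw ⟨y' w, hW y' hy' w w.2⟩
      simpa using congrArg Subtype.val this
    simp [hΦ, h1]
  have key := eq_zero_of_forall_commutator h (LinearMap.trace F W ∘ₗ Φ) (by
    intro y hy y' hy'
    rw [LinearMap.comp_apply, map_sub, hmul _ _ hy', hmul _ _ hy, map_sub,
      LinearMap.trace_mul_comm, sub_self]) hx
  have hx' : Φ x = (ψ ∘ₗ W.subtype).smulRight (⟨z, hz⟩ : W) := by
    ext w
    have := hpw ⟨z, hz⟩
    simp [hΦ, hxz w w.2, this]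
  rw [LinearMap.comp_apply, hx', LinearMap.trace_smulRight] at key
  simpa using key

/-- An operator of `L(f)` with image in an invariant subspace that it kills lies in an abelian
ideal. -/
theorem eq_zero_of_mem_of_le_ker (h : LieAlgebra.IsSimple F (L f))
    (W : Submodule F V) (hW : ∀ x ∈ L f, ∀ w ∈ W, x w ∈ W) {x : Module.End F V} (hx : x ∈ L f)
    (hxW : ∀ v, x v ∈ W) (hWx : ∀ w ∈ W, x w = 0) : x = 0 := by
  rw [isSimple_lieSubalgebra_iff] at h
  obtain ⟨⟨a, ha, b, hb, hab⟩, h⟩ := h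
  let P : Submodule F (Module.End F V) :=
    { carrier := {y | y ∈ L f ∧ (∀ v, y v ∈ W) ∧ ∀ w ∈ W, y w = 0}
      add_mem' := by
        rintro y z ⟨h1, h2, h3⟩ ⟨h1', h2', h3'⟩
        exact ⟨add_mem h1 h1', fun v => add_mem (h2 v) (h2' v), fun w hw => by
          simp [h3 w hw, h3' w hw]⟩
      zero_mem' := ⟨zero_mem _, by simp, by simp⟩
      smul_mem' := by
        rintro c y ⟨h1, h2, h3⟩
        exact ⟨(L f).smul_mem c h1, fun v => W.smul_mem c (h2 v), fun w hw => by
          simp [h3 w hw]⟩ }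
  have hP : ∀ y ∈ L f, ∀ z ∈ P, y * z - z * y ∈ P := by
    rintro y hy z ⟨h1, h2, h3⟩
    refine ⟨commutator_mem_L hy h1, fun v => sub_mem (hW y hy _ (h2 v)) (h2 _), fun w hw => ?_⟩
    simp [h3 w hw, h3 _ (hW y hy w hw)]
  rcases h P (fun y hy => hy.1) hP with h0 | h1
  · have : x ∈ P := ⟨hx, hxW, hWx⟩
    rwa [h0, Submodule.mem_bot] at this
  · refine absurd ?_ hab
    ext v
    simp [(h1 ha).2.2 _ ((h1 hb).2.1 v), (h1 hb).2.2 _ ((h1 ha).2.1 v)]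

theorem eq_zero_of_central (h : LieAlgebra.IsSimple F (L f)) {x : Module.End F V} (hx : x ∈ L f)
    (hc : ∀ y ∈ L f, y * x = x * y) : x = 0 := by
  rw [isSimple_lieSubalgebra_iff] at h
  obtain ⟨⟨a, ha, b, hb, hab⟩, h⟩ := h
  have hP : ∀ y ∈ L f, ∀ z ∈ F ∙ x, y * z - z * y ∈ F ∙ x := by
    intro y hy z hz
    obtain ⟨c, rfl⟩ := Submodule.mem_span_singleton.mp hz
    simp [hc y hy]
  rcases h (F ∙ x) ((Submodule.span_singleton_le_iff_mem _ _).mpr hx) hP with h0 | h1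
  · simpa using h0
  · obtain ⟨c, rfl⟩ := Submodule.mem_span_singleton.mp (h1 ha)
    refine absurd ?_ hab
    simp [hc b hb]

end Simple

/-! ### The rank-two operators `T f a b` -/

/-- The operator `v ↦ f(a, v) b - f(v, b) a`. -/
def T (f : LinearMap.BilinForm F V) (a b : V) : Module.End F V :=
  (f a).smulRight b - (f.flip b).smulRight a

theorem T_apply (f : LinearMap.BilinForm F V) (a b v : V) :
    T f a b v = f a v • b - f v b • a := by
  simp [T]

theorem T_add_left (f : LinearMap.BilinForm F V) (a a' b : V) :
    T f (a + a') b = T f a b + T f a' b := by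
  ext v; simp only [T_apply, map_add, LinearMap.add_apply]; module

theorem T_add_right (f : LinearMap.BilinForm F V) (a b b' : V) :
    T f a (b + b') = T f a b + T f a b' := by
  ext v; simp only [T_apply, map_add, LinearMap.add_apply]; module

theorem T_smul_left (f : LinearMap.BilinForm F V) (c : F) (a b : V) :
    T f (c • a) b = c • T f a b := by
  ext v; simp only [T_apply, map_smul, LinearMap.smul_apply, smul_eq_mul]; module

theorem T_smul_right (f : LinearMap.BilinForm F V) (c : F) (a b : V) :
    T f a (c • b) = c • T f a b := by
  ext v; simp only [T_apply, map_smul, LinearMap.smul_apply, smul_eq_mul]; module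

/-- The mixed terms `f v b * f a w` cancel by themselves; the hypothesis matches the other two. It
holds when `a`, `b` are both symmetric or both skew against all vectors, or lie in the right and
left radical respectively. -/
theorem T_mem (f : LinearMap.BilinForm F V) (a b : V)
    (h : ∀ v w, f a v * f b w = f w b * f v a) : T f a b ∈ L f := by
  rw [mem_L_iff]
  intro v w
  simp only [T_apply, map_sub, map_smul, LinearMap.sub_apply, LinearMap.smul_apply, smul_eq_mul]
  linear_combination h v w

theorem commutator_T {f : LinearMap.BilinForm F V} {x : Module.End F V} (hx : x ∈ L f) (a b : V) :
    x * T f a b - T f a b * x = T f (x a) b + T f a (x b) := by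
  rw [mem_L_iff] at hx
  ext v
  simp only [T_apply, map_sub, map_smul, LinearMap.sub_apply, LinearMap.add_apply,
    Module.End.mul_apply, hx]
  module

/-- A basis and its dual give two expansions of the identity, and each half of `T` contributes one
copy of `x`. Dividing by two recovers `x` from the operators `T`. -/
theorem sum_T_dualBasis {ι : Type*} [Fintype ι] [DecidableEq ι] {f : LinearMap.BilinForm F V}
    (hf : f.Nondegenerate) (b : Basis ι F V) {x : Module.End F V} (hx : x ∈ L f) :
    ∑ i, T f (f.dualBasis hf b i) (x (b i)) = (2 : F) • x := by
  rw [mem_L_iff] at hx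
  have h1 : ∀ v, ∑ i, f (f.dualBasis hf b i) v • b i = v := by
    intro v
    conv_rhs => rw [← b.sum_repr v]
    refine Finset.sum_congr rfl fun i _ => ?_
    congr 1
    conv_lhs => rw [← b.sum_repr v]
    simp only [map_sum, map_smul, LinearMap.BilinForm.apply_dualBasis_left, smul_eq_mul,
      mul_ite, mul_one, mul_zero, Finset.sum_ite_eq', Finset.mem_univ, if_true]
  have h2 : ∀ v, ∑ i, f v (b i) • f.dualBasis hf b i = v := by
    intro v
    conv_rhs => rw [← (f.dualBasis hf b).sum_repr v]
    simp
  ext v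
  have hv : ∀ i, f v (x (b i)) = - f (x v) (b i) := fun i => by rw [hx, neg_neg]
  calc (∑ i, T f (f.dualBasis hf b i) (x (b i))) v
      = x (∑ i, f (f.dualBasis hf b i) v • b i) + ∑ i, f (x v) (b i) • f.dualBasis hf b i := by
        simp only [LinearMap.sum_apply, T_apply, hv, map_sum, map_smul, ← Finset.sum_add_distrib]
        refine Finset.sum_congr rfl fun i _ => ?_
        module
    _ = (2 : F) • x v := by rw [h1, h2, two_smul]

/-! ### Characteristic and non-degeneracy -/

section Simple

variable {f : LinearMap.BilinForm F V}

/-- In characteristic two the identity is skew-adjoint, and it is central. -/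
theorem two_ne_zero_of_isSimple [Nontrivial V] (h : LieAlgebra.IsSimple F (L f)) :
    (2 : F) ≠ 0 := by
  intro h2
  have h1 : (1 : Module.End F V) ∈ L f := by
    rw [mem_L_iff]
    intro v w
    have : (2 : F) * f v w = 0 := by rw [h2, zero_mul]
    simp only [Module.End.one_apply]
    linear_combination this
  exact one_ne_zero (eq_zero_of_central h h1 fun y _ => by simp)

theorem separatingRight_of_separatingLeft [FiniteDimensional F V]
    (hf : f.SeparatingLeft) : f.SeparatingRight := by
  intro z hz
  have hinj : Function.Injective f :=
    LinearMap.ker_eq_bot.mp (LinearMap.separatingLeft_iff_ker_eq_bot.mp hf)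
  have hsurj : Function.Surjective f :=
    (LinearMap.injective_iff_surjective_of_finrank_eq_finrank
      Subspace.dual_finrank_eq.symm).mp hinj
  refine (Module.forall_dual_apply_eq_zero_iff F z).mp fun φ => ?_
  obtain ⟨v, rfl⟩ := hsurj φ
  exact hz v

theorem separatingLeft_of_separatingRight [FiniteDimensional F V]
    (hf : f.SeparatingRight) : f.SeparatingLeft :=
  separatingRight_of_separatingLeft (f := f.flip) hf

theorem apply_mem_ker {x : Module.End F V} (hx : x ∈ L f) {u : V} (hu : u ∈ LinearMap.ker f) :
    x u ∈ LinearMap.ker f := by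
  rw [mem_L_iff] at hx
  ext w
  simp [hx, LinearMap.mem_ker.mp hu]

theorem apply_mem_ker_flip {x : Module.End F V} (hx : x ∈ L f) {z : V}
    (hz : z ∈ LinearMap.ker f.flip) : x z ∈ LinearMap.ker f.flip := by
  rw [mem_L_iff] at hx
  have h0 : ∀ v, f v z = 0 := fun v => LinearMap.congr_fun hz v
  refine LinearMap.mem_ker.mpr (LinearMap.ext fun v => ?_)
  have := hx v z
  rw [h0, zero_eq_neg] at this
  exact this

theorem nondegenerate_of_isSimple [FiniteDimensional F V] (h : LieAlgebra.IsSimple F (L f)) :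
    f.Nondegenerate := by
  -- For `u` in both radicals, every `φ ⊗ u` lies in `L f` and has trace `φ u` on their
  -- intersection.
  have hrad : ∀ u, (∀ v, f u v = 0) → (∀ v, f v u = 0) → u = 0 := by
    intro u h1 h2
    refine (Module.forall_dual_apply_eq_zero_iff F u).mp fun φ => ?_
    refine apply_eq_zero_of_invariant h (LinearMap.ker f ⊓ LinearMap.ker f.flip)
      (fun x hx w hw => ⟨apply_mem_ker hx hw.1, apply_mem_ker_flip hx hw.2⟩)
      (x := φ.smulRight u) ?_ φ ⟨LinearMap.ext h1, LinearMap.ext h2⟩ fun w _ => rfl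
    rw [mem_L_iff]
    simp [h1, h2]
  have hTmem : ∀ z u, (∀ v, f v z = 0) → (∀ v, f u v = 0) → T f z u ∈ L f := by
    intro z u hz hu
    refine T_mem f z u fun v w => ?_
    rw [hz, hu, mul_zero, mul_zero]
  have hzu : ∀ z u, (∀ v, f v z = 0) → (∀ v, f u v = 0) → f z u = 0 := by
    intro z u hz hu
    have := apply_eq_zero_of_invariant h (LinearMap.ker f.flip)
      (fun x hx w hw => apply_mem_ker_flip hx hw) (hTmem z u hz hu) (-(f.flip u))
      (LinearMap.ext hz) fun w hw => by
        have : f z w = 0 := LinearMap.congr_fun hw z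
        simp [T_apply, this]
    simpa using this
  -- By `hzu`, `T f z u` kills the sum of the two radicals, which also contains its image.
  have hT : ∀ z u, (∀ v, f v z = 0) → (∀ v, f u v = 0) → T f z u = 0 := by
    intro z u hz hu
    refine eq_zero_of_mem_of_le_ker h (LinearMap.ker f ⊔ LinearMap.ker f.flip) ?_
      (hTmem z u hz hu) ?_ ?_
    · intro x hx w hw
      obtain ⟨a, ha, b, hb, rfl⟩ := Submodule.mem_sup.mp hw
      rw [map_add]
      exact Submodule.add_mem_sup (apply_mem_ker hx ha) (apply_mem_ker_flip hx hb)
    · intro v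
      rw [T_apply]
      exact sub_mem (Submodule.smul_mem _ _ (Submodule.mem_sup_left (LinearMap.ext hu)))
        (Submodule.smul_mem _ _ (Submodule.mem_sup_right (LinearMap.ext hz)))
    · intro w hw
      obtain ⟨a, ha, b, hb, rfl⟩ := Submodule.mem_sup.mp hw
      have ha' : ∀ v, f a v = 0 := fun v => LinearMap.congr_fun ha v
      have hb' : ∀ v, f v b = 0 := fun v => LinearMap.congr_fun hb v
      simp [T_apply, ha', hb', hzu z a hz ha', hzu b u hb' hu]
  by_cases hL : f.SeparatingLeft
  · exact ⟨hL, separatingRight_of_separatingLeft hL⟩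
  · exfalso
    have hR : f.SeparatingRight := by
      intro z hz
      by_contra hz0
      obtain ⟨v, hv⟩ : ∃ v, f z v ≠ 0 := by
        by_contra! hc
        exact hz0 (hrad z hc hz)
      -- `T f z u = 0` makes `u` a multiple of `z`, because `f z v ≠ 0`; then `u` lies in both
      -- radicals.
      refine hL fun u hu => hrad u hu fun w => ?_
      have h1 := LinearMap.congr_fun (hT z u hz hu) v
      rw [T_apply, LinearMap.zero_apply, sub_eq_zero] at h1
      have h2 := congrArg (f w) h1
      simp only [map_smul, smul_eq_mul, hz, mul_zero] at h2
      exact (mul_eq_zero.mp h2).resolve_left hv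
    exact hL (separatingLeft_of_separatingRight hR)

end Simple

/-! ### Splitting into a symmetric and a skew part -/

/-- `V = U ⊥ W` where `f` is symmetric against vectors of `U` and skew against vectors of `W`. -/
structure SymmSkewDecomp (f : LinearMap.BilinForm F V) (U W : Submodule F V) : Prop where
  isOrthogonalDecomp : IsOrthogonalDecomp f U W
  symm : ∀ u ∈ U, ∀ v, f u v = f v u
  skew : ∀ w ∈ W, ∀ v, f w v = - f v w

/-- `σ` is the asymmetry of `f`; `τ` is both its inverse and its adjoint, so `σ - τ` is skew-adjoint
and central, hence zero. The summands are the `±1`-eigenspaces of the involution `σ`, written as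
kernels of `f ∓ f.flip`. -/
theorem exists_symmSkewDecomp_of_isSimple [FiniteDimensional F V] [Nontrivial V]
    {f : LinearMap.BilinForm F V} (h : LieAlgebra.IsSimple F (L f)) :
    ∃ U W : Submodule F V, SymmSkewDecomp f U W := by
  have h2 := two_ne_zero_of_isSimple h
  have hf := nondegenerate_of_isSimple h
  obtain ⟨σ, hσ⟩ : ∃ σ : Module.End F V, ∀ v w, f (σ v) w = f w v :=
    ⟨f.flip.symmCompOfNondegenerate f hf, fun v w =>
      LinearMap.BilinForm.symmCompOfNondegenerate_left_apply f.flip hf w v⟩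
  obtain ⟨τ, hτ⟩ : ∃ τ : Module.End F V, ∀ v w, f w (τ v) = f v w :=
    ⟨f.symmCompOfNondegenerate f.flip hf.flip, fun v w =>
      LinearMap.BilinForm.symmCompOfNondegenerate_left_apply f hf.flip w v⟩
  have hστ : σ - τ = 0 := by
    refine eq_zero_of_central h ?_ ?_
    · rw [mem_L_iff]
      intro v w
      have h1 : f (τ v) w = f v (σ w) := by rw [← hσ, hτ]
      simp only [LinearMap.sub_apply, map_sub, h1, hσ, hτ]
      ring
    · intro y hy
      rw [mem_L_iff] at hy
      have h1 : y * σ = σ * y := by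
        ext v
        rw [← sub_eq_zero]
        refine hf.1 _ fun w => ?_
        have h3 := hy (σ v) w
        have h4 := hy w v
        rw [hσ] at h3
        simp only [Module.End.mul_apply, map_sub, LinearMap.sub_apply, hσ]
        linear_combination h3 - h4
      have h3 : y * τ = τ * y := by
        ext v
        rw [← sub_eq_zero]
        refine hf.2 _ fun w => ?_
        have h4 := hy w (τ v)
        have h5 := hy v w
        rw [hτ] at h4
        simp only [Module.End.mul_apply, map_sub, hτ]
        linear_combination h4 - h5
      rw [mul_sub, sub_mul, h1, h3]
  have hσ' : ∀ v w, f w (σ v) = f v w := by rw [sub_eq_zero.mp hστ]; exact hτ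
  have hσσ : ∀ v, σ (σ v) = v := fun v => by
    rw [← sub_eq_zero]
    refine hf.1 _ fun w => ?_
    rw [map_sub, LinearMap.sub_apply, hσ, hσ', sub_self]
  have hU : ∀ u, u ∈ LinearMap.ker (f - f.flip) ↔ ∀ v, f u v = f v u := fun u => by
    simp [LinearMap.mem_ker, LinearMap.ext_iff, sub_eq_zero]
  have hW : ∀ u, u ∈ LinearMap.ker (f + f.flip) ↔ ∀ v, f u v = - f v u := fun u => by
    simp [LinearMap.mem_ker, LinearMap.ext_iff, add_eq_zero_iff_eq_neg]
  have horth : ∀ u ∈ LinearMap.ker (f - f.flip), ∀ w ∈ LinearMap.ker (f + f.flip),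
      f u w = 0 := by
    intro u hu w hw
    have h3 : 2 * f u w = 0 := by
      linear_combination (hU u).mp hu w + (hW w).mp hw u
    exact (mul_eq_zero.mp h3).resolve_left h2
  refine ⟨_, _, ⟨⟨?_, ?_⟩, horth, ?_⟩, fun u hu => (hU u).mp hu, fun w hw => (hW w).mp hw⟩
  · rw [Submodule.disjoint_def]
    intro u hu hw
    refine hf.1 u fun v => ?_
    have h3 : 2 * f u v = 0 := by
      linear_combination (hU u).mp hu v + (hW u).mp hw v
    exact (mul_eq_zero.mp h3).resolve_left h2
  · rw [codisjoint_iff, eq_top_iff]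
    rintro v -
    rw [Submodule.mem_sup]
    refine ⟨(2 : F)⁻¹ • (v + σ v), ?_, (2 : F)⁻¹ • (v - σ v), ?_, ?_⟩
    · rw [hU]
      intro w
      simp only [map_smul, map_add, LinearMap.smul_apply, LinearMap.add_apply, hσ, hσ', add_comm]
    · rw [hW]
      intro w
      simp only [map_smul, map_sub, LinearMap.smul_apply, LinearMap.sub_apply, hσ, hσ',
        smul_eq_mul]
      ring
    · rw [← smul_add, add_add_sub_cancel, ← two_smul F v, smul_smul, inv_mul_cancel₀ h2, one_smul]
  · intro u hu w hw
    rw [← (hU u).mp hu w]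
    exact horth u hu w hw

namespace SymmSkewDecomp

variable {f : LinearMap.BilinForm F V} {U W : Submodule F V} {x : Module.End F V}

theorem apply_mem_left (D : SymmSkewDecomp f U W) (h2 : (2 : F) ≠ 0) (hf : f.Nondegenerate)
    (hx : x ∈ L f) {u : V} (hu : u ∈ U) : x u ∈ U := by
  rw [mem_L_iff] at hx
  obtain ⟨a, ha, b, hb, hab⟩ :=
    Submodule.mem_sup.mp (D.isOrthogonalDecomp.1.sup_eq_top ▸ Submodule.mem_top : x u ∈ U ⊔ W)
  have hb0 : b = 0 := by
    refine hf.1 b fun v => ?_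
    have h3 : f (x u) v = f v (x u) := by
      rw [hx, D.symm u hu, ← neg_eq_iff_eq_neg.mpr (hx v u)]
    rw [← hab, map_add, map_add, LinearMap.add_apply, D.symm a ha v] at h3
    have h4 : 2 * f b v = 0 := by linear_combination h3 + D.skew b hb v
    exact (mul_eq_zero.mp h4).resolve_left h2
  rwa [← hab, hb0, add_zero]

theorem apply_mem_right (D : SymmSkewDecomp f U W) (h2 : (2 : F) ≠ 0) (hf : f.Nondegenerate)
    (hx : x ∈ L f) {w : V} (hw : w ∈ W) : x w ∈ W := by
  rw [mem_L_iff] at hx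
  obtain ⟨a, ha, b, hb, hab⟩ :=
    Submodule.mem_sup.mp (D.isOrthogonalDecomp.1.sup_eq_top ▸ Submodule.mem_top : x w ∈ U ⊔ W)
  have ha0 : a = 0 := by
    refine hf.1 a fun v => ?_
    have h3 : f (x w) v = - f v (x w) := by
      rw [hx, D.skew w hw, hx, neg_neg]
    rw [← hab, map_add, map_add, LinearMap.add_apply, D.skew b hb v] at h3
    have h4 : 2 * f a v = 0 := by linear_combination h3 + D.symm a ha v
    exact (mul_eq_zero.mp h4).resolve_left h2
  rwa [← hab, ha0, zero_add]

theorem T_mem_left (D : SymmSkewDecomp f U W) {a b : V} (ha : a ∈ U) (hb : b ∈ U) :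
    T f a b ∈ L f :=
  T_mem f a b fun v w => by rw [D.symm a ha, D.symm b hb]; ring

theorem T_mem_right (D : SymmSkewDecomp f U W) {a b : V} (ha : a ∈ W) (hb : b ∈ W) :
    T f a b ∈ L f :=
  T_mem f a b fun v w => by rw [D.skew a ha, D.skew b hb]; ring

/-- The operators of `L f` that kill `W` form an ideal. If it is zero, all `T f a b` with `a, b ∈ U`
vanish and `U` is at most a line; if it is everything, each `T f w w` kills `W`, so `w` is in the
radical. -/
theorem eq_bot_or_finrank_le_one [FiniteDimensional F V] [Nontrivial V]
    (D : SymmSkewDecomp f U W) (h : LieAlgebra.IsSimple F (L f)) :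
    W = ⊥ ∨ finrank F U ≤ 1 := by
  have h2 := two_ne_zero_of_isSimple h
  have hf := nondegenerate_of_isSimple h
  rw [isSimple_lieSubalgebra_iff] at h
  let P : Submodule F (Module.End F V) :=
    { carrier := {y | y ∈ L f ∧ ∀ w ∈ W, y w = 0}
      add_mem' := by
        rintro y z ⟨h1, h3⟩ ⟨h1', h3'⟩
        exact ⟨add_mem h1 h1', fun w hw => by simp [h3 w hw, h3' w hw]⟩
      zero_mem' := ⟨zero_mem _, by simp⟩
      smul_mem' := by
        rintro c y ⟨h1, h3⟩
        exact ⟨(L f).smul_mem c h1, fun w hw => by simp [h3 w hw]⟩ }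
  have hP : ∀ y ∈ L f, ∀ z ∈ P, y * z - z * y ∈ P := by
    rintro y hy z ⟨h1, h3⟩
    refine ⟨commutator_mem_L hy h1, fun w hw => ?_⟩
    simp [h3 w hw, h3 _ (D.apply_mem_right h2 hf hy hw)]
  rcases h.2 P (fun y hy => hy.1) hP with h0 | h1
  · right
    have hT : ∀ a ∈ U, ∀ b ∈ U, T f a b = 0 := by
      intro a ha b hb
      have : T f a b ∈ P := ⟨D.T_mem_left ha hb, fun w hw => by
        rw [T_apply, D.isOrthogonalDecomp.2.1 a ha w hw, D.isOrthogonalDecomp.2.2 b hb w hw,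
          zero_smul, zero_smul, sub_zero]⟩
      rwa [h0, Submodule.mem_bot] at this
    by_cases hU : U = ⊥
    · rw [hU, finrank_bot]
      exact zero_le_one
    obtain ⟨a, ha, ha0⟩ := Submodule.exists_mem_ne_zero_of_ne_bot hU
    obtain ⟨v, hv⟩ : ∃ v, f a v ≠ 0 := by
      by_contra! hc
      exact ha0 (hf.1 a hc)
    refine finrank_le_one (⟨a, ha⟩ : U) fun b => ⟨(f a v)⁻¹ * f v b, Subtype.ext ?_⟩
    have h3 := LinearMap.congr_fun (hT a ha b b.2) v
    rw [T_apply, LinearMap.zero_apply, sub_eq_zero] at h3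
    change ((f a v)⁻¹ * f v b) • a = b
    rw [mul_smul, ← h3, smul_smul, inv_mul_cancel₀ hv, one_smul]
  · left
    rw [eq_bot_iff]
    intro w hw
    by_contra hw0
    refine hw0 (hf.1 w fun v => ?_)
    obtain ⟨a, ha, b, hb, rfl⟩ :=
      Submodule.mem_sup.mp (D.isOrthogonalDecomp.1.sup_eq_top ▸ Submodule.mem_top : v ∈ U ⊔ W)
    have h3 := (h1 (D.T_mem_right hw hw)).2 b hb
    rw [T_apply, D.skew w hw b, ← sub_smul, smul_eq_zero_iff_left hw0] at h3
    have h4 : 2 * f w b = 0 := by linear_combination 2 * D.skew w hw b + h3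
    rw [map_add, D.isOrthogonalDecomp.2.2 a ha w hw, (mul_eq_zero.mp h4).resolve_left h2,
      add_zero]

end SymmSkewDecomp

/-! ### Simplicity in the skew and mixed cases -/

namespace SymmSkewDecomp

variable {f : LinearMap.BilinForm F V} {U W : Submodule F V} {x : Module.End F V}

theorem T_self_apply (D : SymmSkewDecomp f U W) {a : V} (ha : a ∈ W) (v : V) :
    T f a a v = (2 * f a v) • a := by
  rw [T_apply, ← sub_smul]
  congr 1
  linear_combination -D.skew a ha v

theorem T_comm (D : SymmSkewDecomp f U W) {a b : V} (ha : a ∈ W) (hb : b ∈ W) :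
    T f a b = T f b a := by
  ext v
  have h1 : f v b = - f b v := by rw [D.skew b hb, neg_neg]
  have h3 : f v a = - f a v := by rw [D.skew a ha, neg_neg]
  rw [T_apply, T_apply, h1, h3]
  module

theorem apply_self_eq_zero (D : SymmSkewDecomp f U W) (h2 : (2 : F) ≠ 0) {a : V} (ha : a ∈ W) :
    f a a = 0 := by
  have h3 : 2 * f a a = 0 := by linear_combination D.skew a ha a
  exact (mul_eq_zero.mp h3).resolve_left h2

theorem exists_apply_ne_zero (D : SymmSkewDecomp f U W) (hf : f.Nondegenerate) {a : V}
    (ha : a ∈ W) (ha0 : a ≠ 0) : ∃ b ∈ W, f a b ≠ 0 := by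
  by_contra! hc
  refine ha0 (hf.1 a fun v => ?_)
  obtain ⟨u, hu, w, hw, rfl⟩ :=
    Submodule.mem_sup.mp (D.isOrthogonalDecomp.1.sup_eq_top ▸ Submodule.mem_top : v ∈ U ⊔ W)
  rw [map_add, D.isOrthogonalDecomp.2.2 u hu a ha, hc w hw, add_zero]

/-- A skew-adjoint operator of a non-degenerate symmetric form on a line is zero, so `L f` lives
entirely on `W`. -/
theorem apply_left_eq_zero [FiniteDimensional F V] (D : SymmSkewDecomp f U W) (h2 : (2 : F) ≠ 0)
    (hf : f.Nondegenerate) (hU : finrank F U ≤ 1) (hx : x ∈ L f) {u : V} (hu : u ∈ U) :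
    x u = 0 := by
  obtain ⟨e, he⟩ := finrank_le_one_iff.mp hU
  obtain ⟨c, hc⟩ := he ⟨u, hu⟩
  obtain ⟨d, hd⟩ := he ⟨x u, D.apply_mem_left h2 hf hx hu⟩
  replace hc : c • (e : V) = u := congrArg Subtype.val hc
  replace hd : d • (e : V) = x u := congrArg Subtype.val hd
  have h3 : f (x u) u = 0 := by
    have h4 : 2 * f (x u) u = 0 := by
      linear_combination (mem_L_iff f x).mp hx u u - D.symm u hu (x u)
    exact (mul_eq_zero.mp h4).resolve_left h2
  rw [← hd, ← hc] at h3
  simp only [map_smul, LinearMap.smul_apply, smul_eq_mul, mul_eq_zero] at h3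
  rcases h3 with h3 | h3 | h3
  · rw [← hc, h3, zero_smul, map_zero]
  · rw [← hd, h3, zero_smul]
  · have : (e : V) = 0 := by
      refine hf.1 _ fun v => ?_
      obtain ⟨u', hu', w, hw, rfl⟩ := Submodule.mem_sup.mp
        (D.isOrthogonalDecomp.1.sup_eq_top ▸ Submodule.mem_top : v ∈ U ⊔ W)
      obtain ⟨c', hc'⟩ := he ⟨u', hu'⟩
      replace hc' : c' • (e : V) = u' := congrArg Subtype.val hc'
      rw [map_add, ← hc', map_smul, h3, smul_zero, D.isOrthogonalDecomp.2.1 e e.2 w hw, add_zero]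
    rw [← hd, this, smul_zero]

/-- The commutator of `x` with `T f a a` is an element of `P` with eigenvector `a` and eigenvalue `2
* f (x a) a`. Its own commutator with `T f a a` is then `4 * f (x a) a` times `T f a a`. -/
theorem T_self_mem_of_apply_ne_zero (D : SymmSkewDecomp f U W) (h2 : (2 : F) ≠ 0)
    (hf : f.Nondegenerate) {P : Submodule F (Module.End F V)} (hPL : P ≤ (L f).toSubmodule)
    (hP : ∀ x ∈ L f, ∀ y ∈ P, x * y - y * x ∈ P) (hx : x ∈ P) {a : V} (ha : a ∈ W)
    (hxa : f (x a) a ≠ 0) : T f a a ∈ P := by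
  have hP' : ∀ y ∈ P, T f (y a) a + T f a (y a) ∈ P := fun y hy => by
    rw [← commutator_T (hPL hy), ← neg_sub]
    exact neg_mem (hP _ (D.T_mem_right ha ha) y hy)
  have hb : x a ∈ W := D.apply_mem_right h2 hf (hPL hx) ha
  have h3 := hP' _ (hP' x hx)
  have h4 : (T f (x a) a + T f a (x a)) a = (2 * f (x a) a) • a := by
    rw [D.T_comm ha hb, LinearMap.add_apply, T_apply, D.apply_self_eq_zero h2 ha]
    module
  rw [h4, T_smul_left, T_smul_right, ← two_smul F, smul_smul] at h3
  exact (P.smul_mem_iff (mul_ne_zero h2 (mul_ne_zero h2 hxa))).mp h3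

/-- On `W` the form `f (x v) w` is symmetric in `v` and `w`, so polarization applies; on `U` the
operator `x` is zero. -/
theorem exists_apply_self_ne_zero [FiniteDimensional F V] (D : SymmSkewDecomp f U W)
    (h2 : (2 : F) ≠ 0) (hf : f.Nondegenerate) (hU : finrank F U ≤ 1) (hx : x ∈ L f)
    (hx0 : x ≠ 0) : ∃ a ∈ W, f (x a) a ≠ 0 := by
  by_contra! hc
  refine hx0 (LinearMap.ext fun v => ?_)
  obtain ⟨u, hu, w, hw, rfl⟩ :=
    Submodule.mem_sup.mp (D.isOrthogonalDecomp.1.sup_eq_top ▸ Submodule.mem_top : v ∈ U ⊔ W)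
  rw [map_add, D.apply_left_eq_zero h2 hf hU hx hu, zero_add, LinearMap.zero_apply]
  have hxw := D.apply_mem_right h2 hf hx hw
  by_contra h0
  obtain ⟨b, hb, hwb⟩ := D.exists_apply_ne_zero hf hxw h0
  have h3 := hc (w + b) (add_mem hw hb)
  simp only [map_add, LinearMap.add_apply, hc w hw, hc b hb] at h3
  have h4 : 2 * f (x w) b = 0 := by
    linear_combination h3 - (mem_L_iff f x).mp hx b w + D.skew b hb (x w)
  exact hwb ((mul_eq_zero.mp h4).resolve_left h2)

theorem isSimple [FiniteDimensional F V] (D : SymmSkewDecomp f U W)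
    (h2 : (2 : F) ≠ 0) (hf : f.Nondegenerate) (hU : finrank F U ≤ 1) (hW : W ≠ ⊥) :
    LieAlgebra.IsSimple F (L f) := by
  rw [isSimple_lieSubalgebra_iff]
  constructor
  · obtain ⟨w, hw, hw0⟩ := Submodule.exists_mem_ne_zero_of_ne_bot hW
    obtain ⟨v, hv, hwv⟩ := D.exists_apply_ne_zero hf hw hw0
    refine ⟨_, D.T_mem_right hw hw, _, D.T_mem_right hv hv, fun h => ?_⟩
    have h3 := LinearMap.congr_fun h w
    simp only [Module.End.mul_apply, D.T_self_apply hw, D.T_self_apply hv, map_smul,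
      D.apply_self_eq_zero h2 hw, D.skew v hv w, mul_zero, zero_smul, map_zero,
      smul_eq_zero, hw0, or_false] at h3
    simp [h2, hwv] at h3
  intro P hPL hP
  refine or_iff_not_imp_left.mpr fun hP0 => ?_
  obtain ⟨x, hx, hx0⟩ := Submodule.exists_mem_ne_zero_of_ne_bot hP0
  obtain ⟨a, ha, hxa⟩ := D.exists_apply_self_ne_zero h2 hf hU (hPL hx) hx0
  have hTa := D.T_self_mem_of_apply_ne_zero h2 hf hPL hP hx ha hxa
  have hstep : ∀ b ∈ W, T f b b ∈ P → ∀ c ∈ W, f b c ≠ 0 → T f c c ∈ P := by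
    intro b hb hTb c hc hbc
    refine D.T_self_mem_of_apply_ne_zero h2 hf hPL hP hTb hc ?_
    rw [D.T_self_apply hb, map_smul, LinearMap.smul_apply, smul_eq_mul]
    exact mul_ne_zero (mul_ne_zero h2 hbc) hbc
  have ha0 : a ≠ 0 := by
    rintro rfl
    simp at hxa
  have hTself : ∀ c ∈ W, T f c c ∈ P := by
    intro c hc
    by_cases hc0 : c = 0
    · rw [hc0, ← zero_smul F (0 : V), T_smul_left, zero_smul]
      exact zero_mem P
    -- `W` is not the union of two proper subspaces: one of `d₁`, `d₂`, `d₁ + d₂` works as an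
    -- intermediate vector between `a` and `c`.
    obtain ⟨d, hd, had, hdc⟩ : ∃ d ∈ W, f a d ≠ 0 ∧ f d c ≠ 0 := by
      obtain ⟨d₁, hd₁, h₁⟩ := D.exists_apply_ne_zero hf ha ha0
      obtain ⟨d₂, hd₂, h₂⟩ := D.exists_apply_ne_zero hf hc hc0
      have h₂' : f d₂ c ≠ 0 := by rwa [D.skew d₂ hd₂, neg_ne_zero]
      by_cases h3 : f d₁ c = 0
      · by_cases h4 : f a d₂ = 0
        · exact ⟨d₁ + d₂, add_mem hd₁ hd₂, by simp [h4, h₁], by simp [h3, h₂']⟩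
        · exact ⟨d₂, hd₂, h4, h₂'⟩
      · exact ⟨d₁, hd₁, h₁, h3⟩
    exact hstep d hd (hstep a ha hTa d hd had) c hc hdc
  have hTab : ∀ b ∈ W, ∀ c ∈ W, T f b c ∈ P := by
    intro b hb c hc
    have h3 : (2 : F) • T f b c = T f (b + c) (b + c) - T f b b - T f c c := by
      rw [T_add_left, T_add_right, T_add_right, D.T_comm hc hb]
      module
    rw [← P.smul_mem_iff h2, h3]
    exact sub_mem (sub_mem (hTself _ (add_mem hb hc)) (hTself b hb)) (hTself c hc)
  intro y hy
  -- The dual basis need not lie in `W`; the projection `p` along `U` moves it there without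
  -- changing `y`.
  obtain ⟨p, hpU, hpW, hp⟩ : ∃ p : Module.End F V, (∀ u ∈ U, p u = 0) ∧ (∀ w ∈ W, p w = w) ∧
      ∀ v, p v ∈ W := by
    have hc := D.isOrthogonalDecomp.1.symm
    exact ⟨W.projection U hc, fun u hu => Submodule.projection_apply_right hc ⟨u, hu⟩,
      fun w hw => Submodule.projection_apply_of_mem_left hc hw,
      Submodule.projection_apply_mem hc⟩
  have hpa : ∀ a, ∀ w ∈ W, f (p a) w = f a w ∧ f w (p a) = f w a := by
    intro a w hw
    obtain ⟨u, hu, w', hw', rfl⟩ :=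
      Submodule.mem_sup.mp (D.isOrthogonalDecomp.1.sup_eq_top ▸ Submodule.mem_top : a ∈ U ⊔ W)
    simp [hpU u hu, hpW w' hw', D.isOrthogonalDecomp.2.1 u hu w hw,
      D.isOrthogonalDecomp.2.2 u hu w hw]
  have hpy : ∀ v, y (p v) = y v := by
    intro v
    obtain ⟨u, hu, w', hw', rfl⟩ :=
      Submodule.mem_sup.mp (D.isOrthogonalDecomp.1.sup_eq_top ▸ Submodule.mem_top : v ∈ U ⊔ W)
    simp [hpU u hu, hpW w' hw', D.apply_left_eq_zero h2 hf hU hy hu]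
  have hyW : ∀ v, y v ∈ W := fun v => by
    rw [← hpy]
    exact D.apply_mem_right h2 hf hy (hp v)
  have hTp : ∀ a, ∀ b ∈ W, T f (p a) b = p * T f a b * p := by
    intro a b hb
    ext v
    have h3 : f (p a) v = f a (p v) := by
      rw [← (hpa a _ (hp v)).1]
      obtain ⟨u, hu, w', hw', rfl⟩ :=
        Submodule.mem_sup.mp (D.isOrthogonalDecomp.1.sup_eq_top ▸ Submodule.mem_top : v ∈ U ⊔ W)
      simp [hpU u hu, hpW w' hw', D.isOrthogonalDecomp.2.2 u hu _ (hp a)]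
    simp only [Module.End.mul_apply, T_apply, map_sub, map_smul, hpW b hb, h3, (hpa v b hb).1]
  let b := Module.finBasis F V
  have h3 : ∑ i, T f (p (f.dualBasis hf b i)) (y (b i)) = (2 : F) • y := by
    have h4 : ∀ i, T f (p (f.dualBasis hf b i)) (y (b i)) =
        p * T f (f.dualBasis hf b i) (y (b i)) * p := fun i => hTp _ _ (hyW _)
    simp only [h4]
    rw [← Finset.sum_mul, ← Finset.mul_sum, sum_T_dualBasis hf b hy]
    ext v
    simp [hpy, hpW _ (hyW v)]
  change y ∈ P
  rw [← P.smul_mem_iff h2, ← h3]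
  exact sum_mem fun i _ => hTab _ (hp _) _ (hyW _)

end SymmSkewDecomp

/-! ### Simplicity in the symmetric case -/

/-- `b` is an orthogonal basis for the symmetric form `f` without isotropic vectors. -/
structure IsOrthogonalBasis {ι : Type*} (f : LinearMap.BilinForm F V) (b : Basis ι F V) :
    Prop where
  symm : ∀ v w, f v w = f w v
  ortho : ∀ i j, i ≠ j → f (b i) (b j) = 0
  self_ne_zero : ∀ i, f (b i) (b i) ≠ 0

namespace IsOrthogonalBasis

variable {ι : Type*} {f : LinearMap.BilinForm F V} {b : Basis ι F V} {x : Module.End F V}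

theorem T_mem (B : IsOrthogonalBasis f b) (v w : V) : T f v w ∈ L f :=
  BilinLie.T_mem f v w fun a c => by rw [B.symm a v, B.symm w c]; ring

theorem T_swap (B : IsOrthogonalBasis f b) (v w : V) : T f v w = - T f w v := by
  ext u
  rw [LinearMap.neg_apply, T_apply, T_apply, B.symm u v, B.symm u w]
  module

theorem T_self (B : IsOrthogonalBasis f b) (v : V) : T f v v = 0 := by
  ext u
  rw [LinearMap.zero_apply, T_apply, B.symm u v, sub_self]

theorem T_apply_left (B : IsOrthogonalBasis f b) {i j : ι} (h : i ≠ j) :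
    T f (b i) (b j) (b i) = f (b i) (b i) • b j := by
  rw [T_apply, B.ortho i j h, zero_smul, sub_zero]

theorem T_apply_right (B : IsOrthogonalBasis f b) {i j : ι} (h : i ≠ j) :
    T f (b i) (b j) (b j) = -(f (b j) (b j)) • b i := by
  rw [T_apply, B.ortho i j h, zero_smul, zero_sub, neg_smul]

theorem T_apply_of_ne (B : IsOrthogonalBasis f b) {i j k : ι} (hi : i ≠ k) (hj : j ≠ k) :
    T f (b i) (b j) (b k) = 0 := by
  rw [T_apply, B.ortho i k hi, B.ortho k j hj.symm, zero_smul, zero_smul, sub_zero]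

theorem nondegenerate (B : IsOrthogonalBasis f b) : f.Nondegenerate :=
  LinearMap.IsOrthoᵢ.nondegenerate_of_not_isOrtho_basis_self b (fun i j h => B.ortho i j h)
    B.self_ne_zero

/-- The entries `f (b k) (x (b l))` serve as coordinates below; on `L f` they form an antisymmetric
matrix. -/
theorem ext_zero (B : IsOrthogonalBasis f b) (h : ∀ k l, f (b k) (x (b l)) = 0) : x = 0 := by
  refine b.ext fun l => ?_
  rw [LinearMap.zero_apply]
  have hx : f.flip (x (b l)) = 0 := b.ext fun k => by simpa using h k l
  refine B.nondegenerate.2 _ fun v => ?_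
  simpa using LinearMap.congr_fun hx v

theorem coord_swap (B : IsOrthogonalBasis f b) (hx : x ∈ L f) (k l : ι) :
    f (b k) (x (b l)) = - f (b l) (x (b k)) := by
  rw [B.symm (b l), (mem_L_iff f x).mp hx, neg_neg]

theorem coord_self (B : IsOrthogonalBasis f b) (h2 : (2 : F) ≠ 0) (hx : x ∈ L f) (k : ι) :
    f (b k) (x (b k)) = 0 := by
  have h : 2 * f (b k) (x (b k)) = 0 := by linear_combination B.coord_swap hx k k
  exact (mul_eq_zero.mp h).resolve_left h2

theorem coord_T_of_ne (B : IsOrthogonalBasis f b) {i j k l : ι} (h1 : ¬ (k = i ∧ l = j))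
    (h2 : ¬ (k = j ∧ l = i)) : f (b k) (T f (b i) (b j) (b l)) = 0 := by
  rw [T_apply, map_sub, map_smul, map_smul, smul_eq_mul, smul_eq_mul]
  have h3 : f (b i) (b l) * f (b k) (b j) = 0 := by
    by_cases hl : i = l
    · rw [B.ortho k j fun hk => h2 ⟨hk, hl.symm⟩, mul_zero]
    · rw [B.ortho i l hl, zero_mul]
  have h4 : f (b l) (b j) * f (b k) (b i) = 0 := by
    by_cases hl : l = j
    · rw [B.ortho k i fun hk => h1 ⟨hk, hl⟩, mul_zero]
    · rw [B.ortho l j hl, zero_mul]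
  rw [h3, h4, sub_zero]

theorem coord_T (B : IsOrthogonalBasis f b) {i j : ι} (h : i ≠ j) :
    f (b i) (T f (b i) (b j) (b j)) = - (f (b i) (b i) * f (b j) (b j)) := by
  rw [B.T_apply_right h, map_smul, smul_eq_mul]
  ring

theorem coord_commutator (B : IsOrthogonalBasis f b) (i j k l : ι) :
    f (b k) ((T f (b i) (b j) * x - x * T f (b i) (b j)) (b l)) =
      f (b k) (b j) * f (b i) (x (b l)) - f (b i) (b k) * f (b j) (x (b l))
        - f (b i) (b l) * f (b k) (x (b j)) + f (b l) (b j) * f (b k) (x (b i)) := by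
  have h := (mem_L_iff f _).mp (B.T_mem (b i) (b j)) (b k) (x (b l))
  rw [T_apply] at h
  simp only [LinearMap.sub_apply, Module.End.mul_apply, map_sub, LinearMap.smul_apply, map_smul,
    smul_eq_mul, T_apply f (b i) (b j) (b l)] at h ⊢
  linear_combination h

/-- `T f (b i) (b j)` generates the rotations of the plane of `b i`, `b j`. It commutes with the
block-diagonal part of `x`, since skew operators of a plane commute. -/
theorem coord_commutator_eq_zero (B : IsOrthogonalBasis f b) (h2 : (2 : F) ≠ 0) (hx : x ∈ L f)
    {i j : ι} (hij : i ≠ j) {k l : ι} (h : k = i ∨ k = j ↔ l = i ∨ l = j) :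
    f (b k) ((T f (b i) (b j) * x - x * T f (b i) (b j)) (b l)) = 0 := by
  by_cases hkl : k = l
  · rw [hkl]
    exact B.coord_self h2 (commutator_mem_L (B.T_mem (b i) (b j)) hx) l
  have s := B.coord_self h2 hx
  rw [B.coord_commutator]
  by_cases hk : k = i ∨ k = j
  · have hl := h.mp hk
    rcases hk with rfl | rfl <;> rcases hl with rfl | rfl
    · exact absurd rfl hkl
    · rw [B.ortho _ _ hij, s, s]
      ring
    · rw [B.ortho _ _ hij, s, s]
      ring
    · exact absurd rfl hkl
  · have hl : ¬ (l = i ∨ l = j) := fun hl => hk (h.mpr hl)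
    rw [not_or] at hk hl
    rw [B.ortho _ _ hk.2, B.ortho _ _ (Ne.symm hk.1), B.ortho _ _ (Ne.symm hl.1),
      B.ortho _ _ hl.2]
    ring

/-- The square of `ad T(b i, b j)` in coordinates. -/
theorem coord_commutator_commutator (B : IsOrthogonalBasis f b)
    {i j : ι} (hij : i ≠ j) {k l : ι} (h : ¬ (k = i ∨ k = j ↔ l = i ∨ l = j)) :
    f (b k) ((T f (b i) (b j) * (T f (b i) (b j) * x - x * T f (b i) (b j)) -
      (T f (b i) (b j) * x - x * T f (b i) (b j)) * T f (b i) (b j)) (b l)) =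
        - (f (b i) (b i) * f (b j) (b j)) * f (b k) (x (b l)) := by
  by_cases hk : k = i ∨ k = j
  · have hl : ¬ (l = i ∨ l = j) := fun hl => h ⟨fun _ => hl, fun _ => hk⟩
    rw [not_or] at hl
    rcases hk with rfl | rfl <;>
      simp only [B.coord_commutator, B.ortho _ _ hij,
        B.ortho _ _ hl.2, B.ortho _ _ (Ne.symm hl.1)] <;>
      ring
  · have hl : l = i ∨ l = j := by tauto
    rw [not_or] at hk
    rcases hl with rfl | rfl <;>
      simp only [B.coord_commutator, B.ortho _ _ hij,
        B.ortho _ _ hk.2, B.ortho _ _ (Ne.symm hk.1)] <;>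
      ring

/-- An ideal containing an operator with nonzero `(i, j)` coordinate contains one with few other
nonzero coordinates. -/
theorem exists_mem_coord (B : IsOrthogonalBasis f b) (h2 : (2 : F) ≠ 0)
    {P : Submodule F (Module.End F V)} (hPL : P ≤ (L f).toSubmodule)
    (hP : ∀ x ∈ L f, ∀ y ∈ P, x * y - y * x ∈ P) (hx : x ∈ P) {i j : ι} (hij : i ≠ j)
    (hxij : f (b i) (x (b j)) ≠ 0) (S : Finset ι) (hiS : i ∉ S) (hjS : j ∉ S) :
    ∃ y ∈ P, f (b i) (y (b j)) ≠ 0 ∧ ∀ k l, f (b k) (y (b l)) ≠ 0 → ∀ s ∈ S,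
      ¬ (k = i ∨ k = s ↔ l = i ∨ l = s) ∧ ¬ (k = j ∨ k = s ↔ l = j ∨ l = s) := by
  classical
  -- The squared adjoint action of `T f (b p) (b q)` erases an entry unless exactly one index lies
  -- in `{p, q}`, and scales the others by one nonzero constant.
  have step : ∀ p q, p ≠ q → ¬ (i = p ∨ i = q ↔ j = p ∨ j = q) → ∀ y ∈ P,
      f (b i) (y (b j)) ≠ 0 → ∃ z ∈ P, f (b i) (z (b j)) ≠ 0 ∧
        ∀ k l, f (b k) (z (b l)) ≠ 0 →
          f (b k) (y (b l)) ≠ 0 ∧ ¬ (k = p ∨ k = q ↔ l = p ∨ l = q) := by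
    intro p q hpq hp y hy hyij
    refine ⟨_, hP _ (B.T_mem (b p) (b q)) _ (hP _ (B.T_mem (b p) (b q)) y hy), ?_, ?_⟩
    · rw [B.coord_commutator_commutator hpq hp]
      exact mul_ne_zero (neg_ne_zero.mpr (mul_ne_zero (B.self_ne_zero p) (B.self_ne_zero q))) hyij
    · intro k l hkl
      by_cases h : k = p ∨ k = q ↔ l = p ∨ l = q
      · exact absurd (B.coord_commutator_eq_zero h2
          (commutator_mem_L (B.T_mem _ _) (hPL hy)) hpq h) hkl
      · rw [B.coord_commutator_commutator hpq h] at hkl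
        exact ⟨right_ne_zero_of_mul hkl, h⟩
  induction S using Finset.induction_on with
  | empty => exact ⟨x, hx, hxij, by simp⟩
  | insert s S _ ih =>
    rw [Finset.mem_insert, not_or] at hiS hjS
    obtain ⟨y, hy, hyij, hy'⟩ := ih hiS.2 hjS.2
    -- Each of `{i, s}` and `{j, s}` contains exactly one of `i`, `j`, so the entry at `(i, j)`
    -- survives both filters.
    obtain ⟨z, hz, hzij, hz'⟩ := step i s hiS.1 (by tauto) y hy hyij
    obtain ⟨w, hw, hwij, hw'⟩ := step j s hjS.1 (by tauto) z hz hzij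
    refine ⟨w, hw, hwij, fun k l hkl t ht => ?_⟩
    obtain ⟨h1, h3⟩ := hw' k l hkl
    obtain ⟨h4, h5⟩ := hz' k l h1
    rcases Finset.mem_insert.mp ht with rfl | ht
    · exact ⟨h5, h3⟩
    · exact hy' k l h4 t ht

theorem eq_smul_T (B : IsOrthogonalBasis f b) (hx : x ∈ L f) {i j : ι} (hij : i ≠ j)
    (h : ∀ k l, f (b k) (x (b l)) ≠ 0 → k = i ∧ l = j ∨ k = j ∧ l = i) :
    ∃ c : F, x = c • T f (b i) (b j) := by
  have hd := mul_ne_zero (B.self_ne_zero i) (B.self_ne_zero j)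
  refine ⟨-f (b i) (x (b j)) / (f (b i) (b i) * f (b j) (b j)), sub_eq_zero.mp ?_⟩
  have hz : x - (-f (b i) (x (b j)) / (f (b i) (b i) * f (b j) (b j))) • T f (b i) (b j) ∈ L f :=
    sub_mem hx ((L f).smul_mem _ (B.T_mem _ _))
  have hij0 : f (b i) ((x - (-f (b i) (x (b j)) / (f (b i) (b i) * f (b j) (b j))) •
      T f (b i) (b j)) (b j)) = 0 := by
    rw [LinearMap.sub_apply, LinearMap.smul_apply, map_sub, map_smul, B.coord_T hij, smul_eq_mul,
      neg_div, neg_mul_neg, div_mul_cancel₀ _ hd, sub_self]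
  refine B.ext_zero fun k l => ?_
  by_cases h1 : k = i ∧ l = j
  · rw [h1.1, h1.2, hij0]
  by_cases h3 : k = j ∧ l = i
  · rw [h3.1, h3.2, B.coord_swap hz, hij0, neg_zero]
  rw [LinearMap.sub_apply, LinearMap.smul_apply, map_sub, map_smul, B.coord_T_of_ne h1 h3,
    smul_zero, sub_zero]
  by_contra h4
  rcases h k l h4 with h5 | h5
  · exact h1 h5
  · exact h3 h5

theorem commutator_T_T (B : IsOrthogonalBasis f b) {i j k : ι} (hij : i ≠ j) (hik : i ≠ k)
    (hjk : j ≠ k) : T f (b j) (b k) * T f (b i) (b j) - T f (b i) (b j) * T f (b j) (b k) =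
      f (b j) (b j) • T f (b i) (b k) := by
  rw [commutator_T (B.T_mem _ _), B.T_apply_of_ne hij.symm hik.symm, B.T_apply_left hjk,
    T_smul_right, ← zero_smul F (0 : V), T_smul_left, zero_smul, zero_add]

/-- An ideal containing one basis operator is everything. -/
theorem le_of_T_mem [Finite ι] (B : IsOrthogonalBasis f b) (h2 : (2 : F) ≠ 0)
    {P : Submodule F (Module.End F V)}
    (hP : ∀ x ∈ L f, ∀ y ∈ P, x * y - y * x ∈ P) {i j : ι} (hij : i ≠ j)
    (h : T f (b i) (b j) ∈ P) : (L f).toSubmodule ≤ P := by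
  classical
  have := Fintype.ofFinite ι
  have := b.finiteDimensional_of_finite
  have step : ∀ p q, p ≠ q → T f (b p) (b q) ∈ P → ∀ r, p ≠ r → T f (b p) (b r) ∈ P := by
    intro p q hpq hpqP r hpr
    by_cases hqr : q = r
    · rwa [← hqr]
    · have := hP _ (B.T_mem (b q) (b r)) _ hpqP
      rw [B.commutator_T_T hpq hpr hqr] at this
      exact (P.smul_mem_iff (B.self_ne_zero q)).mp this
  have hkl : ∀ k l, T f (b k) (b l) ∈ P := by
    intro k l
    by_cases hkl : k = l
    · rw [hkl, B.T_self]
      exact zero_mem P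
    by_cases hik : i = k
    · rw [← hik] at hkl ⊢
      exact step i j hij h l hkl
    · have h3 := neg_mem (step i j hij h k hik)
      rw [← B.T_swap] at h3
      exact step k i (Ne.symm hik) h3 l hkl
  let Φ := LinearMap.mk₂ F (T f) (T_add_left f) (T_smul_left f) (T_add_right f) (T_smul_right f)
  have hvw : ∀ v w, T f v w ∈ P := by
    intro v w
    change Φ v w ∈ P
    rw [← b.sum_repr v, ← b.sum_repr w]
    simp only [map_sum, LinearMap.sum_apply, map_smul, LinearMap.smul_apply]
    exact sum_mem fun k _ => P.smul_mem _ (sum_mem fun l _ => P.smul_mem _ (hkl _ _))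
  intro y hy
  change y ∈ P
  rw [← P.smul_mem_iff h2, ← sum_T_dualBasis B.nondegenerate b hy]
  exact sum_mem fun k _ => hvw _ _

/-- In dimension four, an ideal containing a combination of two disjoint basis operators contains
a basis operator unless the discriminant is a square. -/
theorem T_mem_of_add_mem (B : IsOrthogonalBasis f b) {P : Submodule F (Module.End F V)}
    (hP : ∀ x ∈ L f, ∀ y ∈ P, x * y - y * x ∈ P) {i j k l : ι} (hij : i ≠ j) (hik : i ≠ k)
    (hil : i ≠ l) (hjk : j ≠ k) (hjl : j ≠ l) (hkl : k ≠ l)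
    (hsq : ¬ IsSquare (f (b i) (b i) * f (b j) (b j) * f (b k) (b k) * f (b l) (b l)))
    {α β : F} (hα : α ≠ 0) (h : α • T f (b i) (b j) + β • T f (b k) (b l) ∈ P) :
    T f (b i) (b j) ∈ P := by
  have h0 : ∀ v, T f 0 v = 0 := fun v => by rw [← zero_smul F (0 : V), T_smul_left, zero_smul]
  have h0' : ∀ v, T f v 0 = 0 := fun v => by rw [← zero_smul F (0 : V), T_smul_right, zero_smul]
  -- Commuting with `T f (b j) (b k)` and then `T f (b i) (b l)` returns a combination of the same
  -- two operators with their roles exchanged.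
  have h1 := hP _ (B.T_mem (b j) (b k)) _ h
  have e1 : T f (b j) (b k) * (α • T f (b i) (b j) + β • T f (b k) (b l)) -
      (α • T f (b i) (b j) + β • T f (b k) (b l)) * T f (b j) (b k) =
      (α * f (b j) (b j)) • T f (b i) (b k) - (β * f (b k) (b k)) • T f (b j) (b l) := by
    have e2 : T f (b j) (b k) * T f (b k) (b l) - T f (b k) (b l) * T f (b j) (b k) =
        -(f (b k) (b k)) • T f (b j) (b l) := by
      rw [commutator_T (B.T_mem _ _), B.T_apply_right hjk, B.T_apply_of_ne hjl hkl, h0', add_zero,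
        T_smul_left]
    rw [mul_add, add_mul, mul_smul_comm, smul_mul_assoc, mul_smul_comm, smul_mul_assoc,
      add_sub_add_comm, ← smul_sub, ← smul_sub, e2, B.commutator_T_T hij hik hjk]
    module
  rw [e1] at h1
  have h3 := hP _ (B.T_mem (b i) (b l)) _ h1
  have e3 : T f (b i) (b l) * ((α * f (b j) (b j)) • T f (b i) (b k) -
      (β * f (b k) (b k)) • T f (b j) (b l)) - ((α * f (b j) (b j)) • T f (b i) (b k) -
      (β * f (b k) (b k)) • T f (b j) (b l)) * T f (b i) (b l) =
      -((α * f (b i) (b i) * f (b j) (b j)) • T f (b k) (b l) +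
        (β * f (b k) (b k) * f (b l) (b l)) • T f (b i) (b j)) := by
    have e4 : T f (b i) (b l) * T f (b i) (b k) - T f (b i) (b k) * T f (b i) (b l) =
        -(f (b i) (b i)) • T f (b k) (b l) := by
      rw [commutator_T (B.T_mem _ _), B.T_apply_left hil, B.T_apply_of_ne hik hkl.symm, h0',
        add_zero, T_smul_left, B.T_swap]
      module
    have e5 : T f (b i) (b l) * T f (b j) (b l) - T f (b j) (b l) * T f (b i) (b l) =
        f (b l) (b l) • T f (b i) (b j) := by
      rw [commutator_T (B.T_mem _ _), B.T_apply_right hil, B.T_apply_of_ne hij hjl.symm, h0,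
        zero_add, T_smul_right, B.T_swap]
      module
    rw [mul_sub, sub_mul, mul_smul_comm, smul_mul_assoc, mul_smul_comm, smul_mul_assoc,
      sub_sub_sub_comm, ← smul_sub, ← smul_sub, e4, e5]
    module
  rw [e3] at h3
  have h4 := add_mem (P.smul_mem (α * f (b i) (b i) * f (b j) (b j)) h) (P.smul_mem β h3)
  have e6 : (α * f (b i) (b i) * f (b j) (b j)) •
      (α • T f (b i) (b j) + β • T f (b k) (b l)) +
      β • -((α * f (b i) (b i) * f (b j) (b j)) • T f (b k) (b l) +
        (β * f (b k) (b k) * f (b l) (b l)) • T f (b i) (b j)) =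
      (α ^ 2 * (f (b i) (b i) * f (b j) (b j)) - β ^ 2 * (f (b k) (b k) * f (b l) (b l))) •
        T f (b i) (b j) := by module
  rw [e6] at h4
  -- If the coefficient vanished, the discriminant would be the square of `α * f (b i) (b i) * f (b
  -- j) (b j) / β`.
  refine (P.smul_mem_iff fun h5 => hsq ?_).mp h4
  have hi := B.self_ne_zero i
  have hj := B.self_ne_zero j
  have hβ : β ≠ 0 := by
    rintro rfl
    have : α ^ 2 * (f (b i) (b i) * f (b j) (b j)) = 0 := by linear_combination h5
    simp [hα, hi, hj] at this
  refine ⟨α * f (b i) (b i) * f (b j) (b j) / β, ?_⟩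
  field_simp
  linear_combination -h5

/-- Filtering with all indices other than `i`, `j` leaves only the entries on `{i, j}`, and, when
exactly two further indices `k`, `l` exist, those on `{k, l}`. The second possibility is dimension
four. -/
theorem isSimple [Fintype ι] (B : IsOrthogonalBasis f b) (h2 : (2 : F) ≠ 0)
    (hcard : 2 < Fintype.card ι)
    (hsq : Fintype.card ι = 4 → ¬ IsSquare (∏ i, f (b i) (b i))) :
    LieAlgebra.IsSimple F (L f) := by
  classical
  rw [isSimple_lieSubalgebra_iff]
  constructor
  · obtain ⟨i, j, k, hij, hik, hjk⟩ := Fintype.two_lt_card_iff.mp hcard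
    refine ⟨_, B.T_mem (b j) (b k), _, B.T_mem (b i) (b j), fun h => ?_⟩
    rw [← sub_eq_zero, B.commutator_T_T hij hik hjk, smul_eq_zero_iff_right (B.self_ne_zero j)] at h
    have h3 := LinearMap.congr_fun h (b i)
    rw [B.T_apply_left hik, LinearMap.zero_apply, smul_eq_zero_iff_right (B.self_ne_zero i)] at h3
    exact b.ne_zero k h3
  intro P hPL hP
  refine or_iff_not_imp_left.mpr fun hP0 => ?_
  obtain ⟨x, hx, hx0⟩ := Submodule.exists_mem_ne_zero_of_ne_bot hP0
  obtain ⟨i, j, hxij⟩ : ∃ i j, f (b i) (x (b j)) ≠ 0 := by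
    by_contra! hc
    exact hx0 (B.ext_zero hc)
  have hij : i ≠ j := by
    rintro rfl
    exact hxij (B.coord_self h2 (hPL hx) i)
  obtain ⟨y, hy, hyij, hy'⟩ := B.exists_mem_coord h2 hPL hP hx hij hxij
    (Finset.univ.filter fun s => s ≠ i ∧ s ≠ j) (by simp) (by simp)
  have hy2 : ∀ k l, f (b k) (y (b l)) ≠ 0 → k ≠ l ∧ (k = i ∧ l = j ∨ k = j ∧ l = i ∨
      ((k ≠ i ∧ k ≠ j) ∧ (l ≠ i ∧ l ≠ j) ∧ ∀ s, s ≠ i → s ≠ j → s = k ∨ s = l)) := by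
    intro k l hkl
    have hne : k ≠ l := by
      rintro rfl
      exact hkl (B.coord_self h2 (hPL hy) k)
    have hs : ∀ s, s ≠ i → s ≠ j → ¬ (k = i ∨ k = s ↔ l = i ∨ l = s) ∧
        ¬ (k = j ∨ k = s ↔ l = j ∨ l = s) := fun s h1 h3 => hy' k l hkl s (by simp [h1, h3])
    refine ⟨hne, ?_⟩
    have hk := hs k
    have hl := hs l
    by_cases hki : k = i
    · grind
    by_cases hkj : k = j
    · grind
    by_cases hli : l = i
    · grind
    by_cases hlj : l = j
    · grind
    refine Or.inr (Or.inr ⟨⟨hki, hkj⟩, ⟨hli, hlj⟩, fun s h1 h3 => ?_⟩)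
    have := (hs s h1 h3).1
    grind
  refine B.le_of_T_mem h2 hP hij ?_
  by_cases hex : ∃ k l, f (b k) (y (b l)) ≠ 0 ∧ k ≠ i ∧ k ≠ j
  · obtain ⟨k, l, hkl, hki, hkj⟩ := hex
    obtain ⟨hne, h3⟩ := hy2 k l hkl
    have h4 : (l ≠ i ∧ l ≠ j) ∧ ∀ s, s ≠ i → s ≠ j → s = k ∨ s = l := by grind
    have huniv : (Finset.univ : Finset ι) = {i, j, k, l} := by
      ext s
      simp only [Finset.mem_univ, Finset.mem_insert, Finset.mem_singleton, true_iff]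
      have := h4.2 s
      tauto
    have hi : i ∉ ({j, k, l} : Finset ι) := by
      simp [hij, hki.symm, h4.1.1.symm]
    have hj : j ∉ ({k, l} : Finset ι) := by
      simp [hkj.symm, h4.1.2.symm]
    have hk : k ∉ ({l} : Finset ι) := by simpa using hne
    have hcard4 : Fintype.card ι = 4 := by
      rw [← Finset.card_univ, huniv, Finset.card_insert_of_notMem hi,
        Finset.card_insert_of_notMem hj, Finset.card_insert_of_notMem hk, Finset.card_singleton]
    have hsq' := hsq hcard4
    rw [huniv, Finset.prod_insert hi, Finset.prod_insert hj, Finset.prod_insert hk,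
      Finset.prod_singleton, ← mul_assoc, ← mul_assoc] at hsq'
    have hdij := mul_ne_zero (B.self_ne_zero i) (B.self_ne_zero j)
    -- `c` is the coefficient of `T f (b i) (b j)` in `y`; what remains is a multiple of `T f (b k)
    -- (b l)`.
    let c : F := -f (b i) (y (b j)) / (f (b i) (b i) * f (b j) (b j))
    have hc : c ≠ 0 := div_ne_zero (neg_ne_zero.mpr hyij) hdij
    have hcd : c * (f (b i) (b i) * f (b j) (b j)) = -f (b i) (y (b j)) := div_mul_cancel₀ _ hdij
    have hcij : f (b i) ((y - c • T f (b i) (b j)) (b j)) = 0 := by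
      rw [LinearMap.sub_apply, LinearMap.smul_apply, map_sub, map_smul, B.coord_T hij, smul_eq_mul,
        mul_neg, hcd, neg_neg, sub_self]
    have hz : y - c • T f (b i) (b j) ∈ L f :=
      sub_mem (hPL hy) ((L f).smul_mem _ (B.T_mem _ _))
    obtain ⟨c', hc'⟩ := B.eq_smul_T hz hne fun p q hpq => by
      by_cases h1 : p = i ∧ q = j
      · rw [h1.1, h1.2] at hpq
        exact absurd hcij hpq
      by_cases h5 : p = j ∧ q = i
      · rw [h5.1, h5.2, B.coord_swap hz, hcij, neg_zero] at hpq
        exact absurd rfl hpq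
      rw [LinearMap.sub_apply, LinearMap.smul_apply, map_sub, map_smul, B.coord_T_of_ne h1 h5,
        smul_zero, sub_zero] at hpq
      have h6 := hy2 p q hpq
      have h7 := h4.2 p
      have h8 := h4.2 q
      grind
    refine B.T_mem_of_add_mem hP hij hki.symm h4.1.1.symm hkj.symm h4.1.2.symm hne hsq' hc
      (β := c') ?_
    rw [← hc', add_sub_cancel]
    exact hy
  · obtain ⟨c, rfl⟩ := B.eq_smul_T (hPL hy) hij fun k l hkl => by
      have h1 := hy2 k l hkl
      have h3 : ¬ (k ≠ i ∧ k ≠ j) := fun h => hex ⟨k, l, hkl, h⟩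
      tauto
    refine (P.smul_mem_iff fun hc => hyij ?_).mp hy
    simp [hc]

end IsOrthogonalBasis

/-! ### Necessity of the dimension and discriminant conditions -/

namespace IsOrthogonalBasis

variable {ι : Type*} {f : LinearMap.BilinForm F V} {x y : Module.End F V}

/-- With at most two indices, all of `L f` consists of multiples of a single `T f (b i) (b j)`,
hence is abelian. -/
theorem two_lt_card_of_isSimple [Fintype ι] {b : Basis ι F V} (B : IsOrthogonalBasis f b)
    (h2 : (2 : F) ≠ 0) (h : LieAlgebra.IsSimple F (L f)) : 2 < Fintype.card ι := by
  classical
  rw [isSimple_lieSubalgebra_iff] at h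
  obtain ⟨⟨x, hx, y, hy, hxy⟩, -⟩ := h
  by_contra hcard
  rw [Fintype.two_lt_card_iff] at hcard
  obtain ⟨i, j, hxij⟩ : ∃ i j, f (b i) (x (b j)) ≠ 0 := by
    by_contra! hc
    exact hxy (by rw [B.ext_zero hc, zero_mul, mul_zero])
  have hij : i ≠ j := by
    rintro rfl
    exact hxij (B.coord_self h2 hx i)
  have hk : ∀ k, k = i ∨ k = j := by
    by_contra! hc
    obtain ⟨k, hki, hkj⟩ := hc
    exact hcard ⟨i, j, k, hij, hki.symm, hkj.symm⟩
  have key : ∀ z ∈ L f, ∃ c : F, z = c • T f (b i) (b j) := by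
    intro z hz
    refine B.eq_smul_T hz hij fun k l hkl => ?_
    have hne : k ≠ l := by
      rintro rfl
      exact hkl (B.coord_self h2 hz k)
    have h1 := hk k
    have h3 := hk l
    grind
  obtain ⟨c, rfl⟩ := key x hx
  obtain ⟨d, rfl⟩ := key y hy
  exact hxy (by simp [smul_smul, mul_comm])

theorem apply_eq_sum [Fintype ι] {b : Basis ι F V} (B : IsOrthogonalBasis f b) (v w : V) :
    f v w = ∑ m, f (b m) v * f (b m) w / f (b m) (b m) := by
  have h : ∀ v m, b.repr v m = f (b m) v / f (b m) (b m) := by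
    intro v m
    rw [eq_div_iff (B.self_ne_zero m)]
    conv_rhs => rw [← b.sum_repr v]
    rw [map_sum, Finset.sum_eq_single m]
    · rw [map_smul, smul_eq_mul]
    · intro k _ hk
      rw [map_smul, B.ortho m k hk.symm, smul_zero]
    · simp
  conv_lhs => rw [← b.sum_repr v]
  rw [map_sum, LinearMap.sum_apply]
  refine Finset.sum_congr rfl fun m _ => ?_
  rw [map_smul, LinearMap.smul_apply, h, smul_eq_mul]
  ring

theorem coord_mul_sub_mul [Fintype ι] {b : Basis ι F V} (B : IsOrthogonalBasis f b) (hx : x ∈ L f)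
    (hy : y ∈ L f) (k l : ι) :
    f (b k) ((x * y - y * x) (b l)) = ∑ m, (f (b k) (x (b m)) * f (b m) (y (b l)) -
      f (b k) (y (b m)) * f (b m) (x (b l))) / f (b m) (b m) := by
  have h1 : ∀ z ∈ L f, ∀ w, f (b k) (z w) = ∑ m, f (b k) (z (b m)) * f (b m) w / f (b m) (b m) := by
    intro z hz w
    rw [← neg_eq_iff_eq_neg.mpr ((mem_L_iff f z).mp hz (b k) w), B.apply_eq_sum,
      ← Finset.sum_neg_distrib]
    refine Finset.sum_congr rfl fun m _ => ?_
    rw [B.coord_swap hz k m]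
    ring
  rw [LinearMap.sub_apply, map_sub, Module.End.mul_apply, Module.End.mul_apply, h1 x hx, h1 y hy,
    ← Finset.sum_sub_distrib]
  exact Finset.sum_congr rfl fun m _ => (sub_div _ _ _).symm

/-- In dimension four with square discriminant, `L(f)` has a proper ideal of self-dual elements. -/
theorem not_isSquare_of_isSimple {b : Basis (Fin 4) F V} (B : IsOrthogonalBasis f b)
    (h2 : (2 : F) ≠ 0) (h : LieAlgebra.IsSimple F (L f)) :
    ¬ IsSquare (∏ i, f (b i) (b i)) := by
  rintro ⟨δ, hδ⟩
  rw [isSimple_lieSubalgebra_iff] at h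
  rw [Fin.prod_univ_four] at hδ
  have n0 := B.self_ne_zero 0
  have n1 := B.self_ne_zero 1
  have n2 := B.self_ne_zero 2
  have n3 := B.self_ne_zero 3
  have nδ : δ ≠ 0 := by
    rintro rfl
    simp [n0, n1, n2, n3] at hδ
  -- Self-duality for a Hodge star on skew matrices: it pairs complementary index pairs, and `δ`
  -- normalizes it to an involution.
  let P : Submodule F (Module.End F V) :=
    { carrier := {x | x ∈ L f ∧
        f (b 2) (b 2) * f (b 3) (b 3) * f (b 0) (x (b 1)) = δ * f (b 2) (x (b 3)) ∧
        f (b 1) (b 1) * f (b 3) (b 3) * f (b 0) (x (b 2)) = -δ * f (b 1) (x (b 3)) ∧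
        f (b 1) (b 1) * f (b 2) (b 2) * f (b 0) (x (b 3)) = δ * f (b 1) (x (b 2))}
      add_mem' := by
        rintro x y ⟨h1, h3, h4, h5⟩ ⟨h1', h3', h4', h5'⟩
        refine ⟨add_mem h1 h1', ?_, ?_, ?_⟩ <;> simp only [LinearMap.add_apply, map_add, mul_add, *]
      zero_mem' := ⟨zero_mem _, by simp, by simp, by simp⟩
      smul_mem' := by
        rintro c x ⟨h1, h3, h4, h5⟩
        refine ⟨(L f).smul_mem c h1, ?_, ?_, ?_⟩ <;>
          simp only [LinearMap.smul_apply, map_smul, smul_eq_mul, mul_left_comm _ c, *] }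
  have hmem : ∀ x, x ∈ P ↔ x ∈ L f ∧
        f (b 2) (b 2) * f (b 3) (b 3) * f (b 0) (x (b 1)) = δ * f (b 2) (x (b 3)) ∧
        f (b 1) (b 1) * f (b 3) (b 3) * f (b 0) (x (b 2)) = -δ * f (b 1) (x (b 3)) ∧
        f (b 1) (b 1) * f (b 2) (b 2) * f (b 0) (x (b 3)) = δ * f (b 1) (x (b 2)) :=
    fun x => Iff.rfl
  have hP : ∀ x ∈ L f, ∀ y ∈ P, x * y - y * x ∈ P := by
    rintro x hx y hy
    rw [hmem] at hy ⊢
    obtain ⟨hyL, e1, e3, e4⟩ := hy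
    refine ⟨commutator_mem_L hx hyL, ?_⟩
    simp only [B.coord_mul_sub_mul hx hyL, Fin.sum_univ_four, B.coord_self h2 hx,
      B.coord_self h2 hyL, B.coord_swap hx 1 0, B.coord_swap hx 2 0,
      B.coord_swap hx 2 1, B.coord_swap hx 3 1, B.coord_swap hx 3 2, B.coord_swap hyL 1 0,
      B.coord_swap hyL 2 0, B.coord_swap hyL 2 1, B.coord_swap hyL 3 1,
      B.coord_swap hyL 3 2]
    clear hmem P h
    generalize f (b 0) (b 0) = d0 at *
    generalize f (b 1) (b 1) = d1 at *
    generalize f (b 2) (b 2) = d2 at *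
    generalize f (b 3) (b 3) = d3 at *
    generalize f (b 0) (y (b 1)) = y01 at *
    generalize f (b 0) (y (b 2)) = y02 at *
    generalize f (b 0) (y (b 3)) = y03 at *
    -- Solving for `d0` and for the entries of `y` in row `0` leaves identities of rational
    -- functions.
    obtain rfl : d0 = δ * δ / (d1 * d2 * d3) := by
      rw [eq_div_iff (mul_ne_zero (mul_ne_zero n1 n2) n3), ← hδ]
      ring
    obtain rfl := (eq_div_iff (mul_ne_zero n2 n3)).mpr ((mul_comm _ _).trans e1)
    obtain rfl := (eq_div_iff (mul_ne_zero n1 n3)).mpr ((mul_comm _ _).trans e3)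
    obtain rfl := (eq_div_iff (mul_ne_zero n1 n2)).mpr ((mul_comm _ _).trans e4)
    refine ⟨?_, ?_, ?_⟩ <;>
    · field_simp
      ring
  have c01 : ∀ k l : Fin 4, ¬ (k = 0 ∧ l = 1) → ¬ (k = 1 ∧ l = 0) →
      f (b k) (T f (b 0) (b 1) (b l)) = 0 := fun k l => B.coord_T_of_ne
  have c23 : ∀ k l : Fin 4, ¬ (k = 2 ∧ l = 3) → ¬ (k = 3 ∧ l = 2) →
      f (b k) (T f (b 2) (b 3) (b l)) = 0 := fun k l => B.coord_T_of_ne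
  have v01 := B.coord_T (i := 0) (j := 1) (by decide)
  have v23 := B.coord_T (i := 2) (j := 3) (by decide)
  rcases h.2 P (fun x hx => hx.1) hP with h0 | h1
  · let z := T f (b 0) (b 1) + (f (b 0) (b 0) * f (b 1) (b 1) / δ) • T f (b 2) (b 3)
    have hz : z ∈ P := by
      rw [hmem]
      refine ⟨add_mem (B.T_mem _ _) ((L f).smul_mem _ (B.T_mem _ _)), ?_, ?_, ?_⟩ <;>
        simp only [z, LinearMap.add_apply, LinearMap.smul_apply, map_add, map_smul, v01, v23]
      · rw [c01 2 3 (by decide) (by decide), c23 0 1 (by decide) (by decide), smul_eq_mul,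
          smul_eq_mul]
        field_simp
        ring
      · rw [c01 0 2 (by decide) (by decide), c23 0 2 (by decide) (by decide),
          c01 1 3 (by decide) (by decide), c23 1 3 (by decide) (by decide)]
        simp
      · rw [c01 0 3 (by decide) (by decide), c23 0 3 (by decide) (by decide),
          c01 1 2 (by decide) (by decide), c23 1 2 (by decide) (by decide)]
        simp
    rw [h0, Submodule.mem_bot] at hz
    have h3 : f (b 0) (z (b 1)) = 0 := by rw [hz, LinearMap.zero_apply, map_zero]
    simp only [z, LinearMap.add_apply, LinearMap.smul_apply, map_add, map_smul, v01,
      c23 0 1 (by decide) (by decide), smul_zero, add_zero, neg_eq_zero] at h3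
    exact mul_ne_zero n0 n1 h3
  · have h3 := ((hmem _).mp (h1 (B.T_mem (b 0) (b 1)))).2.1
    rw [v01, c01 2 3 (by decide) (by decide), mul_zero, mul_neg, neg_eq_zero] at h3
    exact mul_ne_zero (mul_ne_zero n2 n3) (mul_ne_zero n0 n1) h3

end IsOrthogonalBasis

/-! ### Orthogonal bases, discriminants and the three cases -/

variable {f : LinearMap.BilinForm F V}

theorem exists_isOrthogonalBasis [FiniteDimensional F V] (h2 : (2 : F) ≠ 0) (hf : f.Nondegenerate)
    (hs : f.IsSymm) {n : ℕ} (hn : finrank F V = n) :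
    ∃ b : Basis (Fin n) F V, IsOrthogonalBasis f b := by
  subst hn
  have := invertibleOfNonzero h2
  obtain ⟨b, hb⟩ := LinearMap.BilinForm.exists_orthogonal_basis
    (LinearMap.BilinForm.isSymm_iff.mp hs)
  exact ⟨b, hs.eq, fun i j hij => hb hij,
    LinearMap.BilinForm.iIsOrtho.not_isOrtho_basis_self_of_nondegenerate hb hf⟩

theorem IsOrthogonalBasis.det_toMatrix {ι : Type*} [Fintype ι] [DecidableEq ι] {b : Basis ι F V}
    (B : IsOrthogonalBasis f b) :
    (LinearMap.BilinForm.toMatrix b f).det = ∏ i, f (b i) (b i) := by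
  rw [← Matrix.det_diagonal]
  congr 1
  ext i j
  by_cases h : i = j
  · subst h
    simp [LinearMap.BilinForm.toMatrix_apply]
  · simp [LinearMap.BilinForm.toMatrix_apply, h, B.ortho i j h]

theorem isSquare_det_toMatrix_of_isSquare {ι : Type*} [Fintype ι] [DecidableEq ι]
    (b c : Basis ι F V) (h : IsSquare (LinearMap.BilinForm.toMatrix c f).det) :
    IsSquare (LinearMap.BilinForm.toMatrix b f).det := by
  rw [← LinearMap.BilinForm.toMatrix_mul_basis_toMatrix c b f, Matrix.det_mul, Matrix.det_mul,
    Matrix.det_transpose, mul_right_comm]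
  exact (IsSquare.mul_self _).mul h

theorem isSymmCase_of_isSimple [FiniteDimensional F V] [Nontrivial V]
    (h : LieAlgebra.IsSimple F (L f)) (hs : f.IsSymm) : IsSymmCase f := by
  have h2 := two_ne_zero_of_isSimple h
  have hf := nondegenerate_of_isSimple h
  refine ⟨hs, ?_, fun h4 c hc => ?_⟩
  · obtain ⟨b, B⟩ := exists_isOrthogonalBasis h2 hf hs rfl
    simpa using B.two_lt_card_of_isSimple h2 h
  · obtain ⟨b, B⟩ := exists_isOrthogonalBasis h2 hf hs h4
    refine B.not_isSquare_of_isSimple h2 h ?_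
    rw [← B.det_toMatrix]
    exact isSquare_det_toMatrix_of_isSquare b c hc

theorem isSimple_of_isSymmCase [FiniteDimensional F V] (h2 : (2 : F) ≠ 0) (hf : f.Nondegenerate)
    (hs : IsSymmCase f) : LieAlgebra.IsSimple F (L f) := by
  obtain ⟨hs, hdim, hsq⟩ := hs
  generalize hn : finrank F V = n at hdim hsq
  obtain ⟨b, B⟩ := exists_isOrthogonalBasis h2 hf hs hn
  refine B.isSimple h2 (by simpa using hdim) fun h4 => ?_
  rw [Fintype.card_fin] at h4
  subst h4
  rw [← B.det_toMatrix]
  exact hsq rfl b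

/-- The skew case becomes the mixed case with `U = 0`, so one simplicity proof covers both. -/
theorem symmSkewDecomp_of_isSkewSymm (hs : IsSkewSymm f) : SymmSkewDecomp f ⊥ ⊤ := by
  refine ⟨⟨isCompl_bot_top, ?_, ?_⟩, ?_, fun w _ v => hs w v⟩ <;>
  · intro u hu
    rw [(Submodule.mem_bot F).mp hu]
    simp

theorem symmSkewDecomp_of_restrict {U W : Submodule F V} (h : IsOrthogonalDecomp f U W)
    (hU : (f.restrict U).IsSymm) (hW : IsSkewSymm (f.restrict W)) : SymmSkewDecomp f U W := by
  refine ⟨h, fun u hu v => ?_, fun w hw v => ?_⟩ <;>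
    obtain ⟨a, ha, c, hc, rfl⟩ :=
      Submodule.mem_sup.mp (h.1.sup_eq_top ▸ Submodule.mem_top : v ∈ U ⊔ W)
  · have h1 : f u a = f a u := hU.eq ⟨u, hu⟩ ⟨a, ha⟩
    simp [h1, h.2.1 u hu c hc, h.2.2 u hu c hc]
  · have h1 : f w c = - f c w := hW ⟨w, hw⟩ ⟨c, hc⟩
    simp [h1, h.2.1 a ha w hw, h.2.2 a ha w hw]

/-- A vector that is both symmetric and skew against all of `V` is zero, whereas any two of the
cases together produce a nonzero one. -/
theorem exactlyOne_of_or [Nontrivial V] (h2 : (2 : F) ≠ 0) (hf : f.Nondegenerate)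
    (h : IsSkewSymm f ∨ IsSymmCase f ∨ IsMixedCase f) :
    ExactlyOne (IsSkewSymm f) (IsSymmCase f) (IsMixedCase f) := by
  have hzero : ∀ v, (∀ w, f v w = f w v) → (∀ w, f v w = - f w v) → v = 0 := by
    intro v h1 h3
    refine hf.1 v fun w => ?_
    have h4 : 2 * f v w = 0 := by linear_combination h1 w + h3 w
    exact (mul_eq_zero.mp h4).resolve_left h2
  obtain ⟨v, hv⟩ := exists_ne (0 : V)
  have hAB : IsSkewSymm f → IsSymmCase f → False := fun hA hB =>
    hv (hzero v (hB.1.eq v) (hA v))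
  have hAC : IsSkewSymm f → IsMixedCase f → False := by
    rintro hA ⟨U, W, h, hU, hW, hU1, -⟩
    have : Nontrivial U := Module.nontrivial_of_finrank_pos (R := F) (by omega)
    obtain ⟨u, hu⟩ := exists_ne (0 : U)
    exact hu (Subtype.ext (hzero u ((symmSkewDecomp_of_restrict h hU hW).symm u u.2) (hA u)))
  have hBC : IsSymmCase f → IsMixedCase f → False := by
    rintro hB ⟨U, W, h, hU, hW, -, hW0⟩
    have : Nontrivial W := Module.nontrivial_of_finrank_pos hW0
    obtain ⟨w, hw⟩ := exists_ne (0 : W)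
    exact hw (Subtype.ext (hzero w (hB.1.eq w) ((symmSkewDecomp_of_restrict h hU hW).skew w w.2)))
  unfold ExactlyOne
  tauto

end BilinLie

theorem mainTheorem2 {F V : Type*} [Field F] [AddCommGroup V] [Module F V]
    [FiniteDimensional F V] [Nontrivial V] (f : LinearMap.BilinForm F V) :
    LieAlgebra.IsSimple F (BilinLie.L f) ↔
      ringChar F ≠ 2 ∧ f.Nondegenerate ∧
        BilinLie.ExactlyOne
          (BilinLie.IsSkewSymm f) (BilinLie.IsSymmCase f) (BilinLie.IsMixedCase f) := by
  constructor
  · intro h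
    have h2 := BilinLie.two_ne_zero_of_isSimple h
    have hf := BilinLie.nondegenerate_of_isSimple h
    refine ⟨fun hc => h2 ?_, hf, BilinLie.exactlyOne_of_or h2 hf ?_⟩
    · have := CharP.cast_eq_zero F (ringChar F)
      rwa [hc] at this
    obtain ⟨U, W, D⟩ := BilinLie.exists_symmSkewDecomp_of_isSimple h
    have hUW := D.isOrthogonalDecomp.1
    by_cases hW : W = ⊥
    · have hU : U = ⊤ := by simpa [hW] using hUW.sup_eq_top
      exact Or.inr (Or.inl (BilinLie.isSymmCase_of_isSimple h
        ⟨fun v w => D.symm v (by simp [hU]) w⟩))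
    by_cases hU : U = ⊥
    · have hW : W = ⊤ := by simpa [hU] using hUW.sup_eq_top
      exact Or.inl fun v w => D.skew v (by simp [hW]) w
    have hU1 := (D.eq_bot_or_finrank_le_one h).resolve_left hW
    exact Or.inr (Or.inr ⟨U, W, D.isOrthogonalDecomp, ⟨fun a c => D.symm a a.2 c⟩,
      fun a c => D.skew a a.2 c, le_antisymm hU1 (Submodule.one_le_finrank_iff.mpr hU),
      Submodule.one_le_finrank_iff.mpr hW⟩)
  · rintro ⟨hc, hf, h⟩
    have h2 := Ring.two_ne_zero hc
    rcases h with ⟨h, -, -⟩ | ⟨-, h, -⟩ | ⟨-, -, U, W, h, hU, hW, hU1, hW0⟩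
    · exact (BilinLie.symmSkewDecomp_of_isSkewSymm h).isSimple h2 hf (by simp) top_ne_bot
    · exact BilinLie.isSimple_of_isSymmCase h2 hf h
    · exact (BilinLie.symmSkewDecomp_of_restrict h hU hW).isSimple h2 hf hU1.le
        (Submodule.one_le_finrank_iff.mp hW0)
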